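/- All sequences and functions are real-valued. For a sequence $a=(a_k)_{k\ge1}$ put $\widetilde{a}_n:=\sup_{k\ge n}|a_k|$. Let $\widetilde{l_1}$ be the space of all sequences $a$ with $$\|a\|_{\widetilde{l_1}}:=\sum_{n=1}^\infty \widetilde{a}_n<\infty,$$ and let $ces_\infty$ be the space of all sequences $a$ with $$\|a\|_{ces_\infty}:=\sup_{n\ge1}\frac1n\sum_{k=1}^n|a_k|<\infty .$$ For $m\in\mathbb N$ and $q\in\{1,\infty\}$ let $l_q^m$ be $\mathbb R^m$ with the $l_q$ norm. For Banach spaces $X_n$ ($n\ge0$) let $(\bigoplus_{n\ge0}X_n)_{l_1}$, respectively $(\bigoplus_{n\ge0}X_n)_{l_\infty}$, be the space of all sequences $(x_n)_{n\ge0}$, $x_n\in X_n$, with $\sum_n\|x_n\|<\infty$, respectively $\sup_n\|x_n\|<\infty$, under this norm. Write $X\simeq Y$ if there is a linear homeomorphism of $X$ onto $Y$. A subspace $E$ of a Banach space $X$ is complemented if there is a bounded linear projection of $X$ onto $E$. Then $$\widetilde{l_1}\simeq\Big(\bigoplus_{n=0}^\infty l_\infty^{2^n}\Big)_{l_1},\qquad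 ces_\infty\simeq\Big(\bigoplus_{n=0}^\infty l_1^{2^n}\Big)_{l_\infty},$$ and $ces_\infty$ contains a complemented subspace isomorphic to $L_1[0,1]$ (with Lebesgue measure). -/

import Mathlib

open MeasureTheory
open scoped ENNReal

noncomputable section

/-! Sequences `(a_k)_{k ≥ 1}` of real numbers are functions `a : ℕ → ℝ`, the value `a k` being the
term with number `k + 1`. -/

/-- The discrete Cesàro operator: the `n`-th value (the term with number `n + 1`) is the mean of the
first `n + 1` terms. -/
def cesaroMean (a : ℕ → ℝ) (n : ℕ) : ℝ :=
  (∑ k ∈ Finset.range (n + 1), a k) / ((n : ℝ) + 1)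

/-- The decreasing majorant `sup_{k ≥ n} |a_k|`; it is only used for bounded sequences. -/
def decMajorant (a : ℕ → ℝ) (n : ℕ) : ℝ :=
  ⨆ k : Set.Ici n, |a k|

theorem cesaroMean_abs_nonneg (a : ℕ → ℝ) (n : ℕ) : 0 ≤ cesaroMean (fun k => |a k|) n := by
  unfold cesaroMean
  positivity

theorem cesaroMean_abs_add_le (a b : ℕ → ℝ) (n : ℕ) :
    cesaroMean (fun k => |(a + b) k|) n
      ≤ cesaroMean (fun k => |a k|) n + cesaroMean (fun k => |b k|) n := by
  unfold cesaroMean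
  rw [← add_div, ← Finset.sum_add_distrib]
  gcongr
  exact abs_add_le _ _

theorem cesaroMean_abs_smul (c : ℝ) (a : ℕ → ℝ) (n : ℕ) :
    cesaroMean (fun k => |(c • a) k|) n = |c| * cesaroMean (fun k => |a k|) n := by
  simp only [cesaroMean, Pi.smul_apply, smul_eq_mul, abs_mul]
  rw [← Finset.mul_sum, mul_div_assoc]

theorem decMajorant_nonneg (a : ℕ → ℝ) (n : ℕ) : 0 ≤ decMajorant a n :=
  Real.iSup_nonneg fun _ => abs_nonneg _

theorem bddAbove_tail {a : ℕ → ℝ} (ha : BddAbove (Set.range fun k => |a k|)) (n : ℕ) :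
    BddAbove (Set.range fun k : Set.Ici n => |a k|) := by
  obtain ⟨M, hM⟩ := ha
  refine ⟨M, ?_⟩
  rintro _ ⟨k, rfl⟩
  exact hM ⟨k, rfl⟩

theorem abs_le_decMajorant {a : ℕ → ℝ} (ha : BddAbove (Set.range fun k => |a k|)) {n k : ℕ}
    (h : n ≤ k) : |a k| ≤ decMajorant a n :=
  le_ciSup (bddAbove_tail ha n) (⟨k, h⟩ : Set.Ici n)

theorem decMajorant_add_le {a b : ℕ → ℝ} (ha : BddAbove (Set.range fun k => |a k|))
    (hb : BddAbove (Set.range fun k => |b k|)) (n : ℕ) :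
    decMajorant (a + b) n ≤ decMajorant a n + decMajorant b n := by
  refine ciSup_le fun k => ?_
  exact (abs_add_le _ _).trans
    (add_le_add (abs_le_decMajorant ha k.2) (abs_le_decMajorant hb k.2))

theorem decMajorant_smul (c : ℝ) (a : ℕ → ℝ) (n : ℕ) :
    decMajorant (c • a) n = |c| * decMajorant a n := by
  simp only [decMajorant, Pi.smul_apply, smul_eq_mul, abs_mul]
  exact (Real.mul_iSup_of_nonneg (abs_nonneg c) _).symm

/-- The vector space of the sequences `a` for which the means of `|a|` are bounded. -/
def cesInftySubmodule : Submodule ℝ (ℕ → ℝ) where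
  carrier := {a | BddAbove (Set.range (cesaroMean fun k => |a k|))}
  zero_mem' := ⟨0, by rintro _ ⟨n, rfl⟩; simp [cesaroMean]⟩
  add_mem' := by
    rintro a b ⟨M, hM⟩ ⟨N, hN⟩
    refine ⟨M + N, ?_⟩
    rintro _ ⟨n, rfl⟩
    exact (cesaroMean_abs_add_le a b n).trans (add_le_add (hM ⟨n, rfl⟩) (hN ⟨n, rfl⟩))
  smul_mem' := by
    rintro c a ⟨M, hM⟩
    refine ⟨|c| * M, ?_⟩
    rintro _ ⟨n, rfl⟩
    rw [cesaroMean_abs_smul]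
    exact mul_le_mul_of_nonneg_left (hM ⟨n, rfl⟩) (abs_nonneg c)

/-- The vector space of the bounded sequences whose decreasing majorant is summable. -/
def tandoriSubmodule : Submodule ℝ (ℕ → ℝ) where
  carrier := {a | BddAbove (Set.range fun k => |a k|) ∧ Summable (decMajorant a)}
  zero_mem' := by
    refine ⟨⟨0, by rintro _ ⟨n, rfl⟩; simp⟩, ?_⟩
    have h : decMajorant 0 = 0 := by
      funext n
      simp [decMajorant]
    rw [h]
    exact summable_zero
  add_mem' := by
    rintro a b ⟨ha, ha'⟩ ⟨hb, hb'⟩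
    refine ⟨?_, (ha'.add hb').of_nonneg_of_le (decMajorant_nonneg _) (decMajorant_add_le ha hb)⟩
    obtain ⟨M, hM⟩ := ha
    obtain ⟨N, hN⟩ := hb
    refine ⟨M + N, ?_⟩
    rintro _ ⟨n, rfl⟩
    exact (abs_add_le _ _).trans (add_le_add (hM ⟨n, rfl⟩) (hN ⟨n, rfl⟩))
  smul_mem' := by
    rintro c a ⟨⟨M, hM⟩, ha'⟩
    refine ⟨⟨|c| * M, ?_⟩, ?_⟩
    · rintro _ ⟨n, rfl⟩
      simp only [Pi.smul_apply, smul_eq_mul, abs_mul]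
      exact mul_le_mul_of_nonneg_left (hM ⟨n, rfl⟩) (abs_nonneg c)
    · exact (ha'.mul_left |c|).congr fun n => (decMajorant_smul c a n).symm

/-- The Cesàro sequence space `ces_∞`. -/
def CesInfty : Type := cesInftySubmodule

/-- The Tandori sequence space over `l_1`. -/
def TandoriL1 : Type := tandoriSubmodule

instance : AddCommGroup CesInfty := inferInstanceAs (AddCommGroup cesInftySubmodule)

instance : Module ℝ CesInfty := inferInstanceAs (Module ℝ cesInftySubmodule)

instance : AddCommGroup TandoriL1 := inferInstanceAs (AddCommGroup tandoriSubmodule)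

instance : Module ℝ TandoriL1 := inferInstanceAs (Module ℝ tandoriSubmodule)

/-- The sequence underlying an element of `ces_∞`. -/
def CesInfty.seq (x : CesInfty) : ℕ → ℝ := x.1

/-- The sequence underlying an element of the Tandori space. -/
def TandoriL1.seq (x : TandoriL1) : ℕ → ℝ := x.1

/-- `‖a‖ = sup_n (|a_1| + ⋯ + |a_n|) / n`. -/
instance : Norm CesInfty := ⟨fun x => ⨆ n, cesaroMean (fun k => |x.seq k|) n⟩

/-- `‖a‖ = ∑_n sup_{k ≥ n} |a_k|`. -/
instance : Norm TandoriL1 := ⟨fun x => ∑' n, decMajorant x.seq n⟩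

theorem CesInfty.normCore : NormedSpace.Core ℝ CesInfty where
  norm_nonneg x := Real.iSup_nonneg fun n => cesaroMean_abs_nonneg x.seq n
  norm_smul c x := by
    change (⨆ n, cesaroMean (fun k => |(c • x.seq) k|) n) = |c| * ⨆ n, _
    simp only [cesaroMean_abs_smul]
    exact (Real.mul_iSup_of_nonneg (abs_nonneg c) _).symm
  norm_triangle x y := by
    refine ciSup_le fun n => ?_
    exact (cesaroMean_abs_add_le x.seq y.seq n).trans
      (add_le_add (le_ciSup x.2 n) (le_ciSup y.2 n))
  norm_eq_zero_iff x := by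
    constructor
    · intro h
      apply Subtype.ext
      funext n
      have h1 : cesaroMean (fun k => |x.seq k|) n ≤ 0 := h ▸ le_ciSup x.2 n
      have h2 : ∑ k ∈ Finset.range (n + 1), |x.seq k| ≤ 0 := by
        unfold cesaroMean at h1
        by_contra hc
        push Not at hc
        have : 0 < (∑ k ∈ Finset.range (n + 1), |x.seq k|) / ((n : ℝ) + 1) := by positivity
        linarith
      have h3 : |x.seq n| ≤ ∑ k ∈ Finset.range (n + 1), |x.seq k| :=
        Finset.single_le_sum (f := fun k => |x.seq k|) (fun i _ => abs_nonneg _)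
          (Finset.self_mem_range_succ n)
      exact abs_nonpos_iff.mp (h3.trans h2)
    · rintro rfl
      change (⨆ n, cesaroMean (fun k => |(0 : ℕ → ℝ) k|) n) = 0
      simp [cesaroMean]

theorem TandoriL1.normCore : NormedSpace.Core ℝ TandoriL1 where
  norm_nonneg x := tsum_nonneg fun n => decMajorant_nonneg x.seq n
  norm_smul c x := by
    change (∑' n, decMajorant (c • x.seq) n) = |c| * ∑' n, decMajorant x.seq n
    simp only [decMajorant_smul]
    exact tsum_mul_left
  norm_triangle x y := by
    change (∑' n, decMajorant (x.seq + y.seq) n)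
      ≤ (∑' n, decMajorant x.seq n) + ∑' n, decMajorant y.seq n
    have hx : Summable (decMajorant x.seq) := x.2.2
    have hy : Summable (decMajorant y.seq) := y.2.2
    rw [← hx.tsum_add hy]
    exact Summable.tsum_le_tsum (decMajorant_add_le x.2.1 y.2.1) (x + y).2.2 (hx.add hy)
  norm_eq_zero_iff x := by
    constructor
    · intro h
      apply Subtype.ext
      funext n
      have h1 : decMajorant x.seq n ≤ 0 :=
        h ▸ Summable.le_tsum x.2.2 n fun j _ => decMajorant_nonneg x.seq j
      exact abs_nonpos_iff.mp ((abs_le_decMajorant x.2.1 le_rfl).trans h1)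
    · rintro rfl
      change (∑' n, decMajorant (0 : ℕ → ℝ) n) = 0
      simp [decMajorant]

instance : NormedAddCommGroup CesInfty := NormedAddCommGroup.ofCore CesInfty.normCore

instance : NormedSpace ℝ CesInfty := NormedSpace.ofCore CesInfty.normCore

instance : NormedAddCommGroup TandoriL1 := NormedAddCommGroup.ofCore TandoriL1.normCore

instance : NormedSpace ℝ TandoriL1 := NormedSpace.ofCore TandoriL1.normCore

/-- The space `ℝ^m` with the `l_p` norm. -/
abbrev FinEll (p : ℝ≥0∞) (m : ℕ) : Type := PiLp p fun _ : Fin m => ℝ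

/-- The `l_p` sum, over `n = 0, 1, 2, …`, of the spaces `ℝ^(2^n)` with the `l_q` norm. -/
abbrev DyadicSum (q p : ℝ≥0∞) [Fact (1 ≤ q)] : Type := lp (fun n : ℕ => FinEll q (2 ^ n)) p

/-- The space `L_1[0,1]` of Lebesgue integrable real functions. -/
abbrev L1UnitInterval : Type := Lp ℝ 1 (volume.restrict (Set.Icc (0 : ℝ) 1))

end

/-! Cut a sequence into blocks of lengths 1, 2, 4, …. Up to constant factors, the Cesàro norm is the
supremum of the block sums divided by `2 ^ n`: a block lies inside an initial segment about twice
its length, and conversely block bounds add up geometrically. The Tandori norm is comparable to the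
sum of `2 ^ n` times the block maxima. One bound is Cauchy condensation for the antitone majorant;
the other replaces the supremum over later blocks by the sum `dyadicTail` and sums by parts.
Rescaling the blocks thus gives both isomorphisms. For the copy of `L_1[0,1]`, send `f` to its
integrals over the dyadic intervals, level by level. In the other direction, read block `n` as a
signed mass distribution on the intervals of level `n`, and take ultrafilter limits in `n` of the
mass of each fixed dyadic interval. The limits are additive with total variation at most `‖x‖`, so
their densities form an `L_1`-bounded martingale, which converges a.e.
(`exists_tendsto_dyadicDensity`). The limit depends linearly on `x`. On the image of `f` the
densities are the dyadic means of `f`, which tend to `f` a.e. (`tendsto_dyadicMean`). Hence the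
embedding has a bounded left inverse, and its range is complemented. -/

open Filter Topology

/-! ### Dyadic blocks of a sequence -/

/-- The number of the dyadic block `{2^n - 1, …, 2^(n+1) - 2}` that contains `k`. -/
def dyadicLevel (k : ℕ) : ℕ := Nat.log 2 (k + 1)

theorem two_pow_dyadicLevel_le (k : ℕ) : 2 ^ dyadicLevel k ≤ k + 1 :=
  Nat.pow_log_le_self 2 (Nat.succ_ne_zero k)

theorem lt_two_pow_dyadicLevel_succ (k : ℕ) : k + 1 < 2 ^ (dyadicLevel k + 1) :=
  Nat.lt_pow_succ_log_self one_lt_two _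

theorem dyadicLevel_mono : Monotone dyadicLevel := fun _ _ h =>
  Nat.log_mono_right (Nat.succ_le_succ h)

theorem dyadicLevel_add {n i : ℕ} (hi : i < 2 ^ n) : dyadicLevel (2 ^ n - 1 + i) = n := by
  have h : 1 ≤ 2 ^ n := Nat.one_le_two_pow
  refine Nat.log_eq_of_pow_le_of_lt_pow ?_ ?_
  · omega
  · rw [pow_succ]; omega

/-- Cutting a sequence into dyadic blocks, the block number `n` being multiplied by `w n`. -/
noncomputable def dyadicBlocks (q : ℝ≥0∞) (w : ℕ → ℝ) (hw : ∀ n, w n ≠ 0) :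
    (ℕ → ℝ) ≃ₗ[ℝ] (∀ n, FinEll q (2 ^ n)) where
  toFun a n := WithLp.toLp q fun i => w n * a (2 ^ n - 1 + i)
  map_add' a b := by
    ext n i
    simp [mul_add]
  map_smul' c a := by
    ext n i
    simp [mul_left_comm]
  invFun y k := (w (dyadicLevel k))⁻¹ * y (dyadicLevel k) ⟨k + 1 - 2 ^ dyadicLevel k, by
    have h := lt_two_pow_dyadicLevel_succ k
    have h1 : 1 ≤ 2 ^ dyadicLevel k := Nat.one_le_two_pow
    rw [pow_succ] at h
    omega⟩
  left_inv a := by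
    funext k
    have h := two_pow_dyadicLevel_le k
    have h1 : 1 ≤ 2 ^ dyadicLevel k := Nat.one_le_two_pow
    have h2 : 2 ^ dyadicLevel k - 1 + (k + 1 - 2 ^ dyadicLevel k) = k := by omega
    simp [h2, hw]
  right_inv y := by
    ext n i
    have h1 : 1 ≤ 2 ^ n := Nat.one_le_two_pow
    have key : ∀ (m : ℕ) (hm : m = n) (j : Fin (2 ^ m)) (_ : (j : ℕ) = i),
        w n * ((w m)⁻¹ * y m j) = y n i := by
      rintro m rfl j hj
      rw [Fin.ext hj, mul_inv_cancel_left₀ (hw m)]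
    refine key _ (dyadicLevel_add i.2) _ ?_
    simp only [dyadicLevel_add i.2]
    omega

theorem dyadicBlocks_apply (q : ℝ≥0∞) (w : ℕ → ℝ) (hw : ∀ n, w n ≠ 0) (a : ℕ → ℝ) (n : ℕ)
    (i : Fin (2 ^ n)) : dyadicBlocks q w hw a n i = w n * a (2 ^ n - 1 + i) := rfl

theorem sum_range_two_pow_sub_one (f : ℕ → ℝ) (N : ℕ) :
    ∑ k ∈ Finset.range (2 ^ N - 1), f k
      = ∑ n ∈ Finset.range N, ∑ i : Fin (2 ^ n), f (2 ^ n - 1 + i) := by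
  induction N with
  | zero => simp
  | succ N ih =>
    have h1 : 1 ≤ 2 ^ N := Nat.one_le_two_pow
    have h : 2 ^ (N + 1) - 1 = 2 ^ N - 1 + 2 ^ N := by rw [pow_succ]; omega
    rw [Finset.sum_range_succ, ← ih, h, Finset.sum_range_add,
      Finset.sum_range fun i => f (2 ^ N - 1 + i)]

theorem two_pow_sub_one_cast (n : ℕ) : ((2 ^ n - 1 : ℕ) : ℝ) = 2 ^ n - 1 := by
  rw [Nat.cast_sub Nat.one_le_two_pow]; simp

/-! ### The space `ces_∞` as an `l_∞` sum -/

/-- Block `n` ends the initial segment of length `2 ^ (n + 1) - 1 ≤ 2 * 2 ^ n`, whose sum is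
controlled by one mean. -/
theorem sum_block_le_of_cesaroMean_le {a : ℕ → ℝ} {C : ℝ}
    (h : ∀ n, cesaroMean (fun k => |a k|) n ≤ C) (n : ℕ) :
    ∑ i : Fin (2 ^ n), |a (2 ^ n - 1 + i)| ≤ 2 ^ n * (2 * C) := by
  have hC : 0 ≤ C := (cesaroMean_abs_nonneg a 0).trans (h 0)
  have h1 : 1 ≤ 2 ^ n := Nat.one_le_two_pow
  -- `m` is the last index of block `n`; the mean with index `m` has `m + 1` terms.
  obtain ⟨m, hm⟩ : ∃ m, 2 ^ (n + 1) - 1 = m + 1 :=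
    ⟨2 ^ (n + 1) - 2, by rw [pow_succ]; omega⟩
  have h2 := h m
  unfold cesaroMean at h2
  rw [div_le_iff₀ (by positivity)] at h2
  have h3 : ((m : ℝ) + 1) = 2 ^ (n + 1) - 1 := by
    rw [← two_pow_sub_one_cast, hm]; push_cast; rfl
  rw [h3, ← hm, sum_range_two_pow_sub_one (fun k => |a k|), Finset.sum_range_succ] at h2
  have h4 : 0 ≤ ∑ n ∈ Finset.range n, ∑ i : Fin (2 ^ n), |a (2 ^ n - 1 + i)| := by positivity
  rw [pow_succ] at h2
  nlinarith

/-- Complete the initial segment to the end of the block `N` containing `n`; the block bounds sum to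
`(2 ^ (N + 1) - 1) * C`, and `2 ^ N ≤ n + 1`. -/
theorem cesaroMean_le_of_sum_block_le {a : ℕ → ℝ} {C : ℝ}
    (h : ∀ n, ∑ i : Fin (2 ^ n), |a (2 ^ n - 1 + i)| ≤ 2 ^ n * C) (n : ℕ) :
    cesaroMean (fun k => |a k|) n ≤ 2 * C := by
  have hC : 0 ≤ C := by simpa using (Finset.sum_nonneg fun i _ => abs_nonneg _).trans (h 0)
  unfold cesaroMean
  rw [div_le_iff₀ (by positivity)]
  have h1 := lt_two_pow_dyadicLevel_succ n
  have h2 := two_pow_dyadicLevel_le n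
  set N := dyadicLevel n
  have h2' : (2 : ℝ) ^ N ≤ n + 1 := by exact_mod_cast h2
  calc ∑ k ∈ Finset.range (n + 1), |a k|
      ≤ ∑ k ∈ Finset.range (2 ^ (N + 1) - 1), |a k| :=
        Finset.sum_le_sum_of_subset_of_nonneg (Finset.range_subset_range.2 (by omega))
          fun _ _ _ => abs_nonneg _
    _ ≤ ∑ n ∈ Finset.range (N + 1), 2 ^ n * C := by
        rw [sum_range_two_pow_sub_one fun k => |a k|]
        exact Finset.sum_le_sum fun n _ => h n
    _ = (2 ^ (N + 1) - 1) * C := by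
        rw [← Finset.sum_mul, geom_sum_eq (by norm_num)]; norm_num
    _ ≤ 2 * C * (n + 1) := by rw [pow_succ]; nlinarith

theorem norm_dyadicBlocks_one (a : ℕ → ℝ) {w : ℕ → ℝ} (hw : ∀ n, w n ≠ 0) (n : ℕ) :
    ‖dyadicBlocks 1 w hw a n‖ = |w n| * ∑ i : Fin (2 ^ n), |a (2 ^ n - 1 + i)| := by
  rw [PiLp.norm_eq_of_L1, Finset.mul_sum]
  simp [dyadicBlocks_apply]

theorem inv_two_pow_ne_zero (n : ℕ) : ((2 : ℝ) ^ n)⁻¹ ≠ 0 := by positivity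

theorem norm_dyadicBlocks_inv_le_iff (a : ℕ → ℝ) (n : ℕ) (C : ℝ) :
    ‖dyadicBlocks 1 (fun n => (2 ^ n)⁻¹) inv_two_pow_ne_zero a n‖ ≤ C ↔
      ∑ i : Fin (2 ^ n), |a (2 ^ n - 1 + i)| ≤ 2 ^ n * C := by
  rw [norm_dyadicBlocks_one, abs_of_nonneg (by positivity), inv_mul_le_iff₀ (by positivity)]

theorem CesInfty.cesaroMean_le_norm (x : CesInfty) (n : ℕ) :
    cesaroMean (fun k => |x.seq k|) n ≤ ‖x‖ := le_ciSup x.2 n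

theorem CesInfty.norm_block_le (x : CesInfty) (n : ℕ) :
    ‖dyadicBlocks 1 (fun n => (2 ^ n)⁻¹) inv_two_pow_ne_zero x.seq n‖ ≤ 2 * ‖x‖ :=
  (norm_dyadicBlocks_inv_le_iff _ _ _).2 (sum_block_le_of_cesaroMean_le x.cesaroMean_le_norm n)

theorem DyadicSum.cesaroMean_symm_le (y : DyadicSum 1 ∞) (n : ℕ) :
    cesaroMean (fun k =>
      |(dyadicBlocks 1 (fun n => (2 ^ n)⁻¹) inv_two_pow_ne_zero).symm y.1 k|) n ≤ 2 * ‖y‖ := by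
  refine cesaroMean_le_of_sum_block_le (fun n => ?_) n
  rw [← norm_dyadicBlocks_inv_le_iff]
  refine le_of_eq_of_le ?_ (lp.norm_apply_le_norm ENNReal.top_ne_zero y n)
  exact congrArg norm (congrFun
    ((dyadicBlocks 1 (fun n => (2 ^ n)⁻¹) inv_two_pow_ne_zero).apply_symm_apply y.1) n)

/-- The space `ces_∞` is the `l_∞` sum of its dyadic blocks. -/
noncomputable def CesInfty.linearEquivDyadicSum : CesInfty ≃ₗ[ℝ] DyadicSum 1 ∞ where
  toFun x := ⟨dyadicBlocks 1 (fun n => (2 ^ n)⁻¹) inv_two_pow_ne_zero x.seq,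
    memℓp_infty_iff.2 ⟨2 * ‖x‖, by rintro _ ⟨n, rfl⟩; exact x.norm_block_le n⟩⟩
  map_add' x y := Subtype.ext (map_add (dyadicBlocks 1 _ inv_two_pow_ne_zero) x.seq y.seq)
  map_smul' c x := Subtype.ext (map_smul (dyadicBlocks 1 _ inv_two_pow_ne_zero) c x.seq)
  invFun y := ⟨(dyadicBlocks 1 (fun n => (2 ^ n)⁻¹) inv_two_pow_ne_zero).symm y.1,
    ⟨2 * ‖y‖, by rintro _ ⟨n, rfl⟩; exact DyadicSum.cesaroMean_symm_le y n⟩⟩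
  left_inv x := Subtype.ext ((dyadicBlocks 1 _ inv_two_pow_ne_zero).symm_apply_apply x.seq)
  right_inv y := Subtype.ext ((dyadicBlocks 1 _ inv_two_pow_ne_zero).apply_symm_apply y.1)

/-- The space `ces_∞` is isomorphic to the `l_∞` sum of its dyadic blocks. -/
noncomputable def CesInfty.equivDyadicSum : CesInfty ≃L[ℝ] DyadicSum 1 ∞ :=
  CesInfty.linearEquivDyadicSum.toContinuousLinearEquivOfBounds 2 2
    (fun x => lp.norm_le_of_forall_le (by positivity) x.norm_block_le)
    (fun y => ciSup_le (DyadicSum.cesaroMean_symm_le y))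

/-! ### The Tandori space as an `l_1` sum -/

theorem two_pow_ne_zero_real (n : ℕ) : (2 : ℝ) ^ n ≠ 0 := by positivity

theorem decMajorant_antitone {a : ℕ → ℝ} (ha : BddAbove (Set.range fun k => |a k|)) :
    Antitone (decMajorant a) := fun _ _ h =>
  ciSup_le fun k => abs_le_decMajorant ha (h.trans k.2)

/-- Cauchy condensation: the value of `A` at the start of block `n + 1` is at most each of the `2 ^
n` values in block `n`. The term `n = 0` has no preceding block and gives `A 0`. -/
theorem sum_two_pow_mul_le_of_antitone {A : ℕ → ℝ} (hA : Antitone A) (N : ℕ) :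
    ∑ n ∈ Finset.range (N + 1), 2 ^ n * A (2 ^ n - 1)
      ≤ A 0 + 2 * ∑ k ∈ Finset.range (2 ^ N - 1), A k := by
  rw [sum_range_two_pow_sub_one, Finset.sum_range_succ']
  simp only [pow_zero, one_mul, tsub_self]
  rw [add_comm, Finset.mul_sum]
  refine add_le_add le_rfl (Finset.sum_le_sum fun n _ => ?_)
  have h : ∑ _i : Fin (2 ^ n), A (2 ^ (n + 1) - 1) ≤ ∑ i : Fin (2 ^ n), A (2 ^ n - 1 + i) := by
    refine Finset.sum_le_sum fun i _ => hA ?_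
    have := i.2
    rw [pow_succ]
    omega
  rw [Finset.sum_const, Finset.card_univ, Fintype.card_fin, nsmul_eq_mul] at h
  push_cast at h
  rw [pow_succ (2 : ℝ)]
  linarith

/-- Summation by parts in recursive form: `2 ^ (N + 1) * t (N + 1) = 2 * (2 ^ N * t N) - 2 * b N`,
so the boundary term absorbs each new summand. -/
theorem sum_two_pow_mul_le_of_recurrence {b t : ℕ → ℝ}
    (h : ∀ n, t n = (2 ^ n)⁻¹ * b n + t (n + 1)) (ht : 0 ≤ t 0) (N : ℕ) :
    ∑ n ∈ Finset.range N, 2 ^ n * t n ≤ 2 ^ N * t N + 2 * ∑ n ∈ Finset.range N, b n := by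
  induction N with
  | zero => simpa using ht
  | succ N ih =>
    rw [Finset.sum_range_succ, Finset.sum_range_succ]
    have h1 : 2 ^ N * t N = b N + 2 ^ N * t (N + 1) := by
      rw [h N, mul_add, mul_inv_cancel_left₀ (by positivity)]
    rw [pow_succ]
    linarith

theorem norm_dyadicBlocks_top_le {a w : ℕ → ℝ} (hw : ∀ n, w n ≠ 0) {n : ℕ} {C : ℝ}
    (h : ∀ i : Fin (2 ^ n), |w n| * |a (2 ^ n - 1 + i)| ≤ C) :
    ‖dyadicBlocks ∞ w hw a n‖ ≤ C := by
  rw [PiLp.norm_eq_ciSup]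
  refine ciSup_le fun i => ?_
  rw [dyadicBlocks_apply, Real.norm_eq_abs, abs_mul]
  exact h i

theorem abs_dyadicBlocks_symm_le (q : ℝ≥0∞) [Fact (1 ≤ q)] {w : ℕ → ℝ} (hw : ∀ n, w n ≠ 0)
    (y : ∀ n, FinEll q (2 ^ n)) (k : ℕ) :
    |(dyadicBlocks q w hw).symm y k| ≤ |w (dyadicLevel k)|⁻¹ * ‖y (dyadicLevel k)‖ := by
  change |(w (dyadicLevel k))⁻¹ * y (dyadicLevel k) _| ≤ _
  rw [abs_mul, abs_inv]
  gcongr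
  exact PiLp.norm_apply_le (y (dyadicLevel k)) _

/-- The tail sum `∑_{m ≥ n} 2^(-m) b_m`. -/
noncomputable def dyadicTail (b : ℕ → ℝ) (n : ℕ) : ℝ := ∑' m, (2 ^ (m + n))⁻¹ * b (m + n)

theorem inv_two_pow_mul_le {x : ℝ} (hx : 0 ≤ x) (n : ℕ) : (2 ^ n)⁻¹ * x ≤ x :=
  mul_le_of_le_one_left hx (inv_le_one_of_one_le₀ (one_le_pow₀ one_le_two))

theorem summable_dyadicTail {b : ℕ → ℝ} (hb : Summable b) (hb0 : ∀ n, 0 ≤ b n)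
    (n : ℕ) : Summable fun m => (2 ^ (m + n))⁻¹ * b (m + n) :=
  ((summable_nat_add_iff n).2 hb).of_nonneg_of_le
    (fun m => mul_nonneg (by positivity) (hb0 _)) fun m => inv_two_pow_mul_le (hb0 _) _

theorem dyadicTail_eq {b : ℕ → ℝ} (hb : Summable b) (hb0 : ∀ n, 0 ≤ b n)
    (n : ℕ) : dyadicTail b n = (2 ^ n)⁻¹ * b n + dyadicTail b (n + 1) := by
  unfold dyadicTail
  rw [(summable_dyadicTail hb hb0 n).tsum_eq_zero_add]
  simp [add_assoc, add_comm 1 n]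

theorem dyadicTail_nonneg {b : ℕ → ℝ} (hb0 : ∀ n, 0 ≤ b n) (n : ℕ) : 0 ≤ dyadicTail b n :=
  tsum_nonneg fun m => mul_nonneg (by positivity) (hb0 _)

theorem dyadicTail_antitone {b : ℕ → ℝ} (hb : Summable b) (hb0 : ∀ n, 0 ≤ b n)
    : Antitone (dyadicTail b) :=
  antitone_nat_of_succ_le fun n => by
    rw [dyadicTail_eq hb hb0 n]
    have := hb0 n
    exact le_add_of_nonneg_left (by positivity)

theorem two_pow_mul_dyadicTail_le {b : ℕ → ℝ} (hb : Summable b) (hb0 : ∀ n, 0 ≤ b n)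
    (n : ℕ) : 2 ^ n * dyadicTail b n ≤ ∑' m, b m := by
  unfold dyadicTail
  rw [← tsum_mul_left]
  refine (Summable.tsum_le_tsum (fun m => ?_) ((summable_dyadicTail hb hb0 n).mul_left _)
    ((summable_nat_add_iff n).2 hb)).trans ?_
  · rw [pow_add, mul_inv, mul_comm (_)⁻¹, mul_assoc, mul_inv_cancel_left₀ (by positivity)]
    exact inv_two_pow_mul_le (hb0 _) _
  · rw [← hb.sum_add_tsum_nat_add n]
    exact le_add_of_nonneg_left (Finset.sum_nonneg fun i _ => hb0 i)

theorem sum_two_pow_mul_dyadicTail_le {b : ℕ → ℝ} (hb : Summable b) (hb0 : ∀ n, 0 ≤ b n)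
    (N : ℕ) :
    ∑ n ∈ Finset.range N, 2 ^ n * dyadicTail b n ≤ 3 * ∑' m, b m := by
  have h1 := sum_two_pow_mul_le_of_recurrence (dyadicTail_eq hb hb0) (dyadicTail_nonneg hb0 0) N
  have h2 := two_pow_mul_dyadicTail_le hb hb0 N
  have h3 := hb.sum_le_tsum (Finset.range N) fun i _ => hb0 i
  linarith

/-- Each later `|a j|` is bounded by the leading term of the tail at its own level, and the tails
decrease. The supremum is thereby replaced by a quantity that is constant on blocks and easy to sum.
-/
theorem decMajorant_le_dyadicTail {b : ℕ → ℝ} (hb : Summable b) (hb0 : ∀ n, 0 ≤ b n)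
    {a : ℕ → ℝ}
    (h : ∀ k, |a k| ≤ (2 ^ dyadicLevel k)⁻¹ * b (dyadicLevel k)) (k : ℕ) :
    decMajorant a k ≤ dyadicTail b (dyadicLevel k) := by
  refine ciSup_le fun j => (h j).trans (le_trans ?_
    (dyadicTail_antitone hb hb0 (dyadicLevel_mono j.2)))
  rw [dyadicTail_eq hb hb0]
  exact le_add_of_nonneg_right (dyadicTail_nonneg hb0 _)

theorem sum_decMajorant_le {b : ℕ → ℝ} (hb : Summable b) (hb0 : ∀ n, 0 ≤ b n)
    {a : ℕ → ℝ}
    (h : ∀ k, |a k| ≤ (2 ^ dyadicLevel k)⁻¹ * b (dyadicLevel k)) (K : ℕ) :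
    ∑ k ∈ Finset.range K, decMajorant a k ≤ 3 * ∑' m, b m := by
  -- A crude choice: the first `K` indices lie in the first `K` blocks, and the bound does not
  -- depend on the number of blocks.
  have hK : K ≤ 2 ^ K - 1 := Nat.le_sub_one_of_lt K.lt_two_pow_self
  refine (Finset.sum_le_sum_of_subset_of_nonneg (Finset.range_subset_range.2 hK)
    fun _ _ _ => decMajorant_nonneg _ _).trans
      (le_trans ?_ (sum_two_pow_mul_dyadicTail_le hb hb0 K))
  rw [sum_range_two_pow_sub_one]
  refine Finset.sum_le_sum fun n _ => ?_
  refine (Finset.sum_le_card_nsmul _ _ (dyadicTail b n) fun i _ => ?_).trans_eq (by simp)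
  exact (decMajorant_le_dyadicTail hb hb0 h _).trans_eq (by rw [dyadicLevel_add i.2])

theorem lp.hasSum_norm_one {E : ℕ → Type*} [∀ n, NormedAddCommGroup (E n)]
    (y : lp E 1) : HasSum (fun n => ‖y n‖) ‖y‖ := by
  simpa using lp.hasSum_norm (by simp) y

theorem TandoriL1.sum_norm_block_le (x : TandoriL1) (N : ℕ) :
    ∑ n ∈ Finset.range N, ‖dyadicBlocks ∞ (fun n => 2 ^ n) two_pow_ne_zero_real x.seq n‖
      ≤ 3 * ‖x‖ := by
  have hA := decMajorant_antitone x.2.1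
  have hs : Summable (decMajorant x.seq) := x.2.2
  have h0 : ∀ k, 0 ≤ decMajorant x.seq k := decMajorant_nonneg _
  calc ∑ n ∈ Finset.range N, ‖dyadicBlocks ∞ (fun n => 2 ^ n) two_pow_ne_zero_real x.seq n‖
      ≤ ∑ n ∈ Finset.range (N + 1),
          ‖dyadicBlocks ∞ (fun n => 2 ^ n) two_pow_ne_zero_real x.seq n‖ :=
        Finset.sum_le_sum_of_subset_of_nonneg (Finset.range_subset_range.2 N.le_succ)
          fun _ _ _ => norm_nonneg _
    _ ≤ ∑ n ∈ Finset.range (N + 1), 2 ^ n * decMajorant x.seq (2 ^ n - 1) := by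
        refine Finset.sum_le_sum fun n _ => norm_dyadicBlocks_top_le _ fun i => ?_
        rw [abs_of_nonneg (by positivity)]
        gcongr
        exact abs_le_decMajorant x.2.1 (Nat.le_add_right _ _)
    _ ≤ decMajorant x.seq 0 + 2 * ∑ k ∈ Finset.range (2 ^ N - 1), decMajorant x.seq k :=
        sum_two_pow_mul_le_of_antitone hA N
    _ ≤ ‖x‖ + 2 * ‖x‖ := by
        gcongr
        · exact hs.le_tsum 0 fun k _ => h0 k
        · exact hs.sum_le_tsum _ fun k _ => h0 k
    _ = 3 * ‖x‖ := by ring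

theorem DyadicSum.abs_symm_le (y : DyadicSum ∞ 1) (k : ℕ) :
    |(dyadicBlocks ∞ (fun n => 2 ^ n) two_pow_ne_zero_real).symm y.1 k|
      ≤ (2 ^ dyadicLevel k)⁻¹ * ‖y (dyadicLevel k)‖ := by
  refine (abs_dyadicBlocks_symm_le ∞ two_pow_ne_zero_real y.1 k).trans_eq ?_
  rw [abs_of_nonneg (by positivity)]

theorem DyadicSum.sum_decMajorant_symm_le (y : DyadicSum ∞ 1) (K : ℕ) :
    ∑ k ∈ Finset.range K,
      decMajorant ((dyadicBlocks ∞ (fun n => 2 ^ n) two_pow_ne_zero_real).symm y.1) k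
        ≤ 3 * ‖y‖ := by
  have h := lp.hasSum_norm_one y
  rw [← h.tsum_eq]
  exact sum_decMajorant_le h.summable (fun _ => norm_nonneg _) (DyadicSum.abs_symm_le y) K

/-- The Tandori space over `l_1` is the `l_1` sum of its dyadic blocks. -/
noncomputable def TandoriL1.linearEquivDyadicSum : TandoriL1 ≃ₗ[ℝ] DyadicSum ∞ 1 where
  toFun x := ⟨dyadicBlocks ∞ (fun n => 2 ^ n) two_pow_ne_zero_real x.seq, by
    refine (memℓp_gen_iff (by simp)).2 ?_
    simpa using summable_of_sum_range_le (fun _ => norm_nonneg _) x.sum_norm_block_le⟩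
  map_add' x y := Subtype.ext (map_add (dyadicBlocks ∞ _ two_pow_ne_zero_real) x.seq y.seq)
  map_smul' c x := Subtype.ext (map_smul (dyadicBlocks ∞ _ two_pow_ne_zero_real) c x.seq)
  invFun y := ⟨(dyadicBlocks ∞ (fun n => 2 ^ n) two_pow_ne_zero_real).symm y.1, by
    refine ⟨⟨‖y‖, ?_⟩, summable_of_sum_range_le (decMajorant_nonneg _)
      (DyadicSum.sum_decMajorant_symm_le y)⟩
    rintro _ ⟨k, rfl⟩
    exact (DyadicSum.abs_symm_le y k).trans ((inv_two_pow_mul_le (norm_nonneg _) _).trans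
      (lp.norm_apply_le_norm one_ne_zero y _))⟩
  left_inv x := Subtype.ext ((dyadicBlocks ∞ _ two_pow_ne_zero_real).symm_apply_apply x.seq)
  right_inv y := Subtype.ext ((dyadicBlocks ∞ _ two_pow_ne_zero_real).apply_symm_apply y.1)

/-- The Tandori space over `l_1` is isomorphic to the `l_1` sum of its dyadic blocks. -/
noncomputable def TandoriL1.equivDyadicSum : TandoriL1 ≃L[ℝ] DyadicSum ∞ 1 :=
  TandoriL1.linearEquivDyadicSum.toContinuousLinearEquivOfBounds 3 3
    (fun x => by
      rw [← (lp.hasSum_norm_one _).tsum_eq]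
      exact Real.tsum_le_of_sum_range_le (fun _ => norm_nonneg _) x.sum_norm_block_le)
    (fun y => Real.tsum_le_of_sum_range_le (decMajorant_nonneg _)
      (DyadicSum.sum_decMajorant_symm_le y))

/-! ### Dyadic intervals and their filtration -/

/-- Lebesgue measure on `[0,1]`. -/
noncomputable abbrev unitVolume : Measure ℝ := volume.restrict (Set.Icc (0 : ℝ) 1)

/-- The number of the dyadic interval of length `2^(-n)` that contains `x`. -/
noncomputable def dyadicIndex (n : ℕ) (x : ℝ) : ℤ := ⌊2 ^ n * x⌋

theorem measurable_dyadicIndex (n : ℕ) : Measurable (dyadicIndex n) :=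
  Int.measurable_floor.comp (measurable_const_mul _)

/-- Passing to a coarser level is integer division of the index. This gives the nesting of the
intervals and matches them with the grouping of coordinates in `DyadicSum.mass`. -/
theorem dyadicIndex_add_div (m j : ℕ) (x : ℝ) :
    dyadicIndex (m + j) x / 2 ^ j = dyadicIndex m x := by
  have h := Int.cast_mul_floor_div_cancel_of_pos (n := 2 ^ j) (by positivity) (2 ^ m * x)
  rw [dyadicIndex, dyadicIndex, ← h, pow_add]
  push_cast
  ring_nf

theorem tendsto_dyadicIndex_div (x : ℝ) :
    Tendsto (fun n => (dyadicIndex n x : ℝ) / 2 ^ n) atTop (𝓝 x) := by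
  have h0 : Tendsto (fun n : ℕ => ((2 : ℝ) ^ n)⁻¹) atTop (𝓝 0) :=
    (tendsto_pow_atTop_atTop_of_one_lt one_lt_two).inv_tendsto_atTop
  have h1 : Tendsto (fun n : ℕ => x - ((2 : ℝ) ^ n)⁻¹) atTop (𝓝 x) := by
    simpa using h0.const_sub x
  refine tendsto_of_tendsto_of_tendsto_of_le_of_le h1 tendsto_const_nhds (fun n => ?_) fun n => ?_
  · have h := Int.lt_floor_add_one ((2 : ℝ) ^ n * x)
    have h2 : x - ((2 : ℝ) ^ n)⁻¹ = (2 ^ n * x - 1) / 2 ^ n := by field_simp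
    simp only [h2, dyadicIndex]
    gcongr
    linarith
  · have h := Int.floor_le ((2 : ℝ) ^ n * x)
    simp only [dyadicIndex]
    rw [div_le_iff₀' (by positivity)]
    exact h

/-- The filtration of the real line by the dyadic intervals of length `2^(-n)`. -/
noncomputable def dyadicFiltration : Filtration ℕ (inferInstance : MeasurableSpace ℝ) where
  seq n := MeasurableSpace.comap (dyadicIndex n) ⊤
  mono' := monotone_nat_of_le_succ fun n => by
    rintro _ ⟨T, -, rfl⟩
    refine ⟨(fun k => k / 2 ^ 1) ⁻¹' T, trivial, ?_⟩
    ext x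
    simp only [Set.mem_preimage, dyadicIndex_add_div]
  le' n := (measurable_dyadicIndex n).comap_le

theorem measurable_dyadicIndex_dyadicFiltration (n : ℕ) :
    Measurable[dyadicFiltration n] (dyadicIndex n) :=
  comap_measurable _

/-- The identity map is a pointwise limit of functions of the dyadic indices, hence measurable for
the supremum. -/
theorem iSup_dyadicFiltration :
    (⨆ n, dyadicFiltration n) = (inferInstance : MeasurableSpace ℝ) := by
  refine le_antisymm (iSup_le dyadicFiltration.le) ?_
  have h : Measurable[⨆ n, dyadicFiltration n] (id : ℝ → ℝ) := by
    refine @measurable_of_tendsto_metrizable _ _ (⨆ n, dyadicFiltration n) _ _ _ _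
      (fun n x => (dyadicIndex n x : ℝ) / 2 ^ n) _ (fun n => ?_)
      (tendsto_pi_nhds.2 tendsto_dyadicIndex_div)
    have h1 : Measurable[⨆ n, dyadicFiltration n] (dyadicIndex n) :=
      (measurable_dyadicIndex_dyadicFiltration n).mono (le_iSup _ n) le_rfl
    exact (measurable_of_countable fun k : ℤ => (k : ℝ) / 2 ^ n).comp h1
  intro s hs
  exact h hs

/-- The dyadic interval `[k / 2^n, (k + 1) / 2^n)`. -/
def dyadicInterval (n : ℕ) (k : ℤ) : Set ℝ := dyadicIndex n ⁻¹' {k}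

theorem measurableSet_dyadicInterval (n : ℕ) (k : ℤ) : MeasurableSet (dyadicInterval n k) :=
  measurable_dyadicIndex n (measurableSet_singleton k)

theorem dyadicInterval_eq_Ico (n : ℕ) (k : ℤ) :
    dyadicInterval n k = Set.Ico ((k : ℝ) / 2 ^ n) ((k + 1 : ℝ) / 2 ^ n) := by
  ext x
  simp only [dyadicInterval, Set.mem_preimage, Set.mem_singleton_iff, dyadicIndex, Int.floor_eq_iff,
    Set.mem_Ico]
  rw [div_le_iff₀ (by positivity), lt_div_iff₀ (by positivity), mul_comm]

theorem unitVolume_real_dyadicInterval (n : ℕ) (i : Fin (2 ^ n)) :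
    unitVolume.real (dyadicInterval n (i : ℕ)) = (2 ^ n)⁻¹ := by
  have hi : (((i : ℕ) : ℝ) + 1) ≤ 2 ^ n := by exact_mod_cast i.2
  have hsub : dyadicInterval n (i : ℕ) ⊆ Set.Icc 0 1 := by
    rw [dyadicInterval_eq_Ico]
    refine Set.Ico_subset_Icc_self.trans (Set.Icc_subset_Icc ?_ ?_)
    · push_cast; positivity
    · rw [div_le_one (by positivity)]
      exact_mod_cast hi
  rw [measureReal_restrict_apply (measurableSet_dyadicInterval _ _),
    Set.inter_eq_self_of_subset_left hsub, dyadicInterval_eq_Ico, Real.volume_real_Ico_of_le]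
  · field_simp
    ring
  · gcongr
    linarith

/-- Only the point `1` has index `2 ^ n`, and it is a null set. -/
theorem ae_exists_dyadicIndex_eq (n : ℕ) :
    ∀ᵐ x ∂unitVolume, ∃ i : Fin (2 ^ n), dyadicIndex n x = (i : ℕ) := by
  have h1 : ∀ᵐ x ∂unitVolume, x ≠ 1 := Measure.ae_ne _ _
  filter_upwards [h1, ae_restrict_mem measurableSet_Icc] with x hx hx'
  have hx1 : x < 1 := lt_of_le_of_ne hx'.2 hx
  have h0 : 0 ≤ dyadicIndex n x := Int.floor_nonneg.2 (mul_nonneg (by positivity) hx'.1)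
  have h2 : dyadicIndex n x < 2 ^ n := by
    refine Int.floor_lt.2 ?_
    push_cast
    exact mul_lt_of_lt_one_right (by positivity) hx1
  refine ⟨⟨(dyadicIndex n x).toNat, ?_⟩, ?_⟩
  · zify
    rwa [Int.toNat_of_nonneg h0]
  · simp [Int.toNat_of_nonneg h0]

open Classical in
theorem setIntegral_preimage_dyadicIndex {f : ℝ → ℝ} (hf : Integrable f unitVolume) (n : ℕ)
    (T : Set ℤ) :
    ∫ x in dyadicIndex n ⁻¹' T, f x ∂unitVolume
      = ∑ i : Fin (2 ^ n), if ((i : ℕ) : ℤ) ∈ T then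
          ∫ x in dyadicInterval n (i : ℕ), f x ∂unitVolume else 0 := by
  have h1 : (dyadicIndex n ⁻¹' T : Set ℝ) =ᵐ[unitVolume]
      (⋃ i : Fin (2 ^ n), dyadicInterval n (i : ℕ) ∩ dyadicIndex n ⁻¹' T : Set ℝ) := by
    filter_upwards [ae_exists_dyadicIndex_eq n] with x ⟨i, hi⟩
    refine propext ⟨fun h => Set.mem_iUnion.2 ⟨i, hi, h⟩, fun h => ?_⟩
    obtain ⟨j, hj⟩ := Set.mem_iUnion.1 h
    exact hj.2
  rw [setIntegral_congr_set h1, integral_iUnion_fintype]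
  · refine Finset.sum_congr rfl fun i _ => ?_
    split_ifs with h
    · rw [Set.inter_eq_self_of_subset_left]
      intro x hx
      rw [Set.mem_preimage, show dyadicIndex n x = _ from hx]
      exact h
    · convert setIntegral_empty
      refine Set.eq_empty_of_forall_notMem fun x hx => h ?_
      rw [← show dyadicIndex n x = _ from hx.1]
      exact hx.2
  · exact fun i => (measurableSet_dyadicInterval _ _).inter
      (measurable_dyadicIndex n (MeasurableSet.of_discrete))
  · intro i j hij
    refine Set.disjoint_left.2 fun x hx hx' => hij ?_
    have := (show dyadicIndex n x = _ from hx.1).symm.trans (show dyadicIndex n x = _ from hx'.1)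
    exact Fin.ext (by exact_mod_cast this)
  · exact fun i => hf.integrableOn

theorem integral_eq_sum_dyadicInterval {f : ℝ → ℝ} (hf : Integrable f unitVolume) (n : ℕ) :
    ∫ x, f x ∂unitVolume
      = ∑ i : Fin (2 ^ n), ∫ x in dyadicInterval n (i : ℕ), f x ∂unitVolume := by
  simpa using setIntegral_preimage_dyadicIndex hf n Set.univ

theorem integrable_comp_dyadicIndex (n : ℕ) (φ : ℤ → ℝ) :
    Integrable (fun x => φ (dyadicIndex n x)) unitVolume := by
  refine Integrable.of_bound
    ((measurable_of_countable φ).comp (measurable_dyadicIndex n)).aestronglyMeasurable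
    (∑ i : Fin (2 ^ n), |φ (i : ℕ)|) ?_
  filter_upwards [ae_exists_dyadicIndex_eq n] with x ⟨i, hi⟩
  rw [hi]
  exact Finset.single_le_sum (f := fun i : Fin (2 ^ n) => |φ (i : ℕ)|) (fun _ _ => abs_nonneg _)
    (Finset.mem_univ i)

theorem setIntegral_comp_dyadicIndex (n : ℕ) (φ : ℤ → ℝ) (i : Fin (2 ^ n)) :
    ∫ x in dyadicInterval n (i : ℕ), φ (dyadicIndex n x) ∂unitVolume
      = (2 ^ n)⁻¹ * φ (i : ℕ) := by
  rw [setIntegral_congr_fun (g := fun _ => φ (i : ℕ)) (measurableSet_dyadicInterval _ _),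
    setIntegral_const, unitVolume_real_dyadicInterval, smul_eq_mul]
  intro x hx
  exact congrArg φ hx

/-! ### Almost everywhere convergence of dyadic means -/

/-- The mean of `f` over the dyadic interval of length `2^(-n)` that contains `x`. -/
noncomputable def dyadicMean (f : ℝ → ℝ) (n : ℕ) (x : ℝ) : ℝ :=
  2 ^ n * ∫ y in dyadicInterval n (dyadicIndex n x), f y ∂unitVolume

theorem stronglyMeasurable_comp_dyadicIndex (n : ℕ) (φ : ℤ → ℝ) :
    StronglyMeasurable[dyadicFiltration n] fun x => φ (dyadicIndex n x) :=
  ((measurable_of_countable φ).comp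
    (measurable_dyadicIndex_dyadicFiltration n)).stronglyMeasurable

/-- A set of level `n` is, up to a null set in `[0,1]`, a finite union of dyadic intervals, and both
functions have the same integral over each of these. -/
theorem dyadicMean_ae_eq_condExp {f : ℝ → ℝ} (hf : Integrable f unitVolume) (n : ℕ) :
    dyadicMean f n =ᵐ[unitVolume] unitVolume[f | dyadicFiltration n] := by
  set φ : ℤ → ℝ := fun k => 2 ^ n * ∫ y in dyadicInterval n k, f y ∂unitVolume with hφ
  have h1 : dyadicMean f n = fun x => φ (dyadicIndex n x) := rfl
  rw [h1]
  refine ae_eq_condExp_of_forall_setIntegral_eq (dyadicFiltration.le n) hf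
    (fun s _ _ => (integrable_comp_dyadicIndex n φ).integrableOn) ?_
    (stronglyMeasurable_comp_dyadicIndex n φ).aestronglyMeasurable
  rintro _ ⟨T, -, rfl⟩ -
  rw [setIntegral_preimage_dyadicIndex (integrable_comp_dyadicIndex n φ),
    setIntegral_preimage_dyadicIndex hf]
  refine Finset.sum_congr rfl fun i _ => ?_
  rw [setIntegral_comp_dyadicIndex n φ i, hφ, inv_mul_cancel_left₀ (by positivity)]

/-- Lévy's upward theorem, since the dyadic levels generate the Borel sets. -/
theorem tendsto_dyadicMean {f : ℝ → ℝ} (hf : Integrable f unitVolume) :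
    ∀ᵐ x ∂unitVolume, Tendsto (fun n => dyadicMean f n x) atTop (𝓝 (f x)) := by
  -- A strongly measurable representative is its own conditional expectation on the full σ-algebra;
  -- passing to it leaves the dyadic means unchanged.
  have h1 := tendsto_ae_condExp (μ := unitVolume) (ℱ := dyadicFiltration) (hf.1.mk f)
  have h3 : Integrable (hf.1.mk f) unitVolume := hf.congr hf.1.ae_eq_mk
  rw [iSup_dyadicFiltration,
    condExp_of_stronglyMeasurable le_rfl hf.1.stronglyMeasurable_mk h3] at h1
  have h2 := ae_all_iff.2 fun n => dyadicMean_ae_eq_condExp h3 n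
  filter_upwards [h1, h2, hf.1.ae_eq_mk] with x hx hx2 hx3
  rw [hx3]
  refine hx.congr fun n => ?_
  rw [← hx2 n, dyadicMean, dyadicMean]
  congr 1
  exact integral_congr_ae (ae_restrict_of_ae hf.1.ae_eq_mk.symm)

theorem dyadicInterval_succ_union (n : ℕ) (k : ℤ) :
    dyadicInterval n k = dyadicInterval (n + 1) (2 * k) ∪ dyadicInterval (n + 1) (2 * k + 1) := by
  ext x
  have h := dyadicIndex_add_div n 1 x
  simp only [dyadicInterval, Set.mem_preimage, Set.mem_singleton_iff, Set.mem_union]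
  omega

/-! ### Densities of additive functions of dyadic intervals -/

/-- The density with respect to Lebesgue measure, at the level `n`, of an additive function `c` of
dyadic intervals. -/
noncomputable def dyadicDensity (c : ℕ → ℤ → ℝ) (n : ℕ) (x : ℝ) : ℝ := 2 ^ n * c n (dyadicIndex n x)

theorem dyadicMean_dyadicDensity_succ {c : ℕ → ℤ → ℝ} {n : ℕ} {x : ℝ}
    (hc : ∀ k, c n k = c (n + 1) (2 * k) + c (n + 1) (2 * k + 1))
    (hx : ∃ i : Fin (2 ^ n), dyadicIndex n x = (i : ℕ)) :
    dyadicMean (dyadicDensity c (n + 1)) n x = dyadicDensity c n x := by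
  obtain ⟨i, hi⟩ := hx
  have hint : Integrable (dyadicDensity c (n + 1)) unitVolume :=
    integrable_comp_dyadicIndex (n + 1) fun k => 2 ^ (n + 1) * c (n + 1) k
  have key : ∀ j : Fin (2 ^ (n + 1)),
      ∫ y in dyadicInterval (n + 1) (j : ℕ), dyadicDensity c (n + 1) y ∂unitVolume
        = c (n + 1) (j : ℕ) := fun j => by
    refine (setIntegral_comp_dyadicIndex (n + 1) (fun k => 2 ^ (n + 1) * c (n + 1) k) j).trans ?_
    rw [inv_mul_cancel_left₀ (by positivity)]
  have h0 := key ⟨2 * i, by have := i.2; rw [pow_succ]; omega⟩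
  have h1 := key ⟨2 * i + 1, by have := i.2; rw [pow_succ]; omega⟩
  push_cast at h0 h1
  rw [dyadicMean, dyadicDensity, hi, dyadicInterval_succ_union, setIntegral_union, h0, h1, hc]
  · refine Set.disjoint_left.2 fun y hy hy' => ?_
    simp only [dyadicInterval, Set.mem_preimage, Set.mem_singleton_iff] at hy hy'
    omega
  · exact measurableSet_dyadicInterval _ _
  · exact hint.integrableOn
  · exact hint.integrableOn

/-- Additivity over the two halves of an interval says that averaging the finer density over that
interval returns the coarser one. -/
theorem martingale_dyadicDensity {c : ℕ → ℤ → ℝ}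
    (hc : ∀ n k, c n k = c (n + 1) (2 * k) + c (n + 1) (2 * k + 1)) :
    Martingale (dyadicDensity c) dyadicFiltration unitVolume := by
  have hint : ∀ n, Integrable (dyadicDensity c n) unitVolume := fun n =>
    integrable_comp_dyadicIndex n fun k => 2 ^ n * c n k
  refine martingale_nat
    (fun n => stronglyMeasurable_comp_dyadicIndex n fun k => 2 ^ n * c n k) hint fun n => ?_
  refine EventuallyEq.trans ?_ (dyadicMean_ae_eq_condExp (hint (n + 1)) n)
  filter_upwards [ae_exists_dyadicIndex_eq n] with x hx
  exact (dyadicMean_dyadicDensity_succ (hc n) hx).symm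

theorem eLpNorm_dyadicDensity (c : ℕ → ℤ → ℝ) (n : ℕ) :
    eLpNorm (dyadicDensity c n) 1 unitVolume
      = ENNReal.ofReal (∑ i : Fin (2 ^ n), |c n (i : ℕ)|) := by
  have hint : Integrable (dyadicDensity c n) unitVolume :=
    integrable_comp_dyadicIndex n fun k => 2 ^ n * c n k
  rw [eLpNorm_one_eq_lintegral_enorm, ← ofReal_integral_norm_eq_lintegral_enorm hint,
    integral_eq_sum_dyadicInterval hint.norm n]
  congr 1
  refine Finset.sum_congr rfl fun i _ => ?_
  refine (setIntegral_comp_dyadicIndex n (fun k => ‖2 ^ n * c n k‖) i).trans ?_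
  rw [norm_mul, Real.norm_of_nonneg (by positivity), inv_mul_cancel_left₀ (by positivity),
    Real.norm_eq_abs]

/-- Doob's convergence theorem for `L_1`-bounded martingales, with Fatou's lemma for the norm.
Convergence is only a.e.: a singular part of `c` may be lost. -/
theorem exists_tendsto_dyadicDensity {c : ℕ → ℤ → ℝ}
    (hc : ∀ n k, c n k = c (n + 1) (2 * k) + c (n + 1) (2 * k + 1)) {R : ℝ}
    (hR : ∀ n, ∑ i : Fin (2 ^ n), |c n (i : ℕ)| ≤ R) :
    ∃ g : L1UnitInterval,
      (∀ᵐ x ∂unitVolume, Tendsto (fun n => dyadicDensity c n x) atTop (𝓝 (g x))) ∧ ‖g‖ ≤ R := by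
  have hR0 : 0 ≤ R := (Finset.sum_nonneg fun _ _ => abs_nonneg _).trans (hR 0)
  have hsub := (martingale_dyadicDensity hc).submartingale
  have hbd : ∀ n, eLpNorm (dyadicDensity c n) 1 unitVolume ≤ (R.toNNReal : ℝ≥0∞) := fun n => by
    rw [eLpNorm_dyadicDensity]
    exact ENNReal.ofReal_le_ofReal (hR n)
  have hmem := hsub.memLp_limitProcess hbd
  have hlim : ∀ᵐ x ∂unitVolume,
      Tendsto (fun n => dyadicDensity c n x) atTop (𝓝 (hmem.toLp _ x)) := by
    filter_upwards [hsub.ae_tendsto_limitProcess hbd, hmem.coeFn_toLp] with x hx hx'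
    rwa [hx']
  refine ⟨hmem.toLp _, hlim, ?_⟩
  rw [Lp.norm_def]
  refine ENNReal.toReal_le_of_le_ofReal hR0 ?_
  refine (Lp.eLpNorm_lim_le_liminf_eLpNorm
    (fun n => (martingale_dyadicDensity hc).integrable n |>.1) _ hlim).trans ?_
  exact (liminf_le_liminf (Eventually.of_forall hbd)).trans_eq (liminf_const _)

/-! ### Ultrafilter limits and the operator onto `L_1[0,1]` -/

/-- The limit of a bounded sequence along a fixed nonprincipal ultrafilter. -/
noncomputable def ultraLim (f : ℕ → ℝ) : ℝ := limUnder (hyperfilter ℕ : Filter ℕ) f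

theorem tendsto_ultraLim {f : ℕ → ℝ} {C : ℝ} (h : ∀ n, |f n| ≤ C) :
    Tendsto f (hyperfilter ℕ : Filter ℕ) (𝓝 (ultraLim f)) := by
  refine tendsto_nhds_limUnder ?_
  obtain ⟨l, -, hl⟩ := (isCompact_Icc (a := -C) (b := C)).ultrafilter_le_nhds
    ((hyperfilter ℕ).map f) (le_principal_iff.2
      (mem_map.2 (univ_mem' fun n => abs_le.1 (h n))))
  exact ⟨l, hl⟩

theorem ultraLim_eq_of_tendsto {f : ℕ → ℝ} {l : ℝ}
    (h : Tendsto f (hyperfilter ℕ : Filter ℕ) (𝓝 l)) : ultraLim f = l := h.limUnder_eq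

theorem eventually_hyperfilter_ge (m : ℕ) : ∀ᶠ n in (hyperfilter ℕ : Filter ℕ), m ≤ n :=
  Nat.hyperfilter_le_atTop (eventually_ge_atTop m)

/-- The mass that the coordinates of the block number `n` give to the dyadic interval number `k` of
length `2^(-m)`. -/
def DyadicSum.mass (x : DyadicSum 1 ∞) (m : ℕ) (k : ℤ) (n : ℕ) : ℝ :=
  ∑ i : Fin (2 ^ n), if ((i : ℕ) : ℤ) / 2 ^ (n - m) = k then x n i else 0

namespace DyadicSum

theorem sum_abs_le_norm (x : DyadicSum 1 ∞) (n : ℕ) : ∑ i, |x n i| ≤ ‖x‖ := by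
  have h := lp.norm_apply_le_norm ENNReal.top_ne_zero x n
  rwa [PiLp.norm_eq_of_L1] at h

theorem abs_mass_le_norm (x : DyadicSum 1 ∞) (m : ℕ) (k : ℤ) (n : ℕ) : |x.mass m k n| ≤ ‖x‖ := by
  refine (Finset.abs_sum_le_sum_abs _ _).trans
    ((Finset.sum_le_sum fun i _ => ?_).trans (x.sum_abs_le_norm n))
  split_ifs <;> simp

/-- For fixed `m` and `n`, each coordinate contributes to at most one interval. -/
theorem sum_abs_mass_le_norm (x : DyadicSum 1 ∞) (m n : ℕ) :
    ∑ k : Fin (2 ^ m), |x.mass m (k : ℕ) n| ≤ ‖x‖ := by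
  calc ∑ k : Fin (2 ^ m), |x.mass m (k : ℕ) n|
      ≤ ∑ k : Fin (2 ^ m), ∑ i : Fin (2 ^ n),
          if ((i : ℕ) : ℤ) / 2 ^ (n - m) = (k : ℕ) then |x n i| else 0 := by
        refine Finset.sum_le_sum fun k _ => (Finset.abs_sum_le_sum_abs _ _).trans_eq ?_
        refine Finset.sum_congr rfl fun i _ => ?_
        split_ifs <;> simp
    _ = ∑ i : Fin (2 ^ n), ∑ k : Fin (2 ^ m),
          if ((i : ℕ) : ℤ) / 2 ^ (n - m) = (k : ℕ) then |x n i| else 0 := Finset.sum_comm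
    _ ≤ ∑ i, |x n i| := by
        refine Finset.sum_le_sum fun i _ => ?_
        -- Splitting into cases avoids having to show that the quotient is below `2 ^ m`.
        by_cases h : ∃ k : Fin (2 ^ m), ((i : ℕ) : ℤ) / 2 ^ (n - m) = (k : ℕ)
        · obtain ⟨k, hk⟩ := h
          rw [Finset.sum_eq_single k _ (by simp), if_pos hk]
          intro j _ hj
          refine if_neg fun h => hj (Fin.ext ?_)
          exact_mod_cast h.symm.trans hk
        · push Not at h
          simp [h]
    _ ≤ ‖x‖ := x.sum_abs_le_norm n

/-- The bound on `n` makes both subtractions in the exponents genuine; for `n = m` they truncate to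
the same value and additivity can fail. -/
theorem mass_eq_add (x : DyadicSum 1 ∞) {m n : ℕ} (h : m + 1 ≤ n) (k : ℤ) :
    x.mass m k n = x.mass (m + 1) (2 * k) n + x.mass (m + 1) (2 * k + 1) n := by
  unfold mass
  rw [← Finset.sum_add_distrib]
  refine Finset.sum_congr rfl fun i _ => ?_
  obtain ⟨d, rfl⟩ := Nat.exists_eq_add_of_le h
  have h1 : m + 1 + d - m = d + 1 := by omega
  have h2 : m + 1 + d - (m + 1) = d := by omega
  rw [h1, h2, pow_succ, ← Int.ediv_ediv_of_nonneg (by positivity)]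
  generalize ((i : ℕ) : ℤ) / 2 ^ d = e
  by_cases h3 : e = 2 * k
  · rw [if_pos (by omega), if_pos h3, if_neg (by omega), add_zero]
  · by_cases h4 : e = 2 * k + 1
    · rw [if_pos (by omega), if_neg h3, if_pos h4, zero_add]
    · rw [if_neg (by omega), if_neg h3, if_neg h4, add_zero]

theorem mass_add (x y : DyadicSum 1 ∞) (m : ℕ) (k : ℤ) (n : ℕ) :
    (x + y).mass m k n = x.mass m k n + y.mass m k n := by
  unfold mass
  rw [← Finset.sum_add_distrib]
  refine Finset.sum_congr rfl fun i _ => ?_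
  split_ifs <;> simp

theorem mass_smul (r : ℝ) (x : DyadicSum 1 ∞) (m : ℕ) (k : ℤ) (n : ℕ) :
    (r • x).mass m k n = r * x.mass m k n := by
  unfold mass
  rw [Finset.mul_sum]
  refine Finset.sum_congr rfl fun i _ => ?_
  split_ifs <;> simp

/-- The limit mass of the dyadic interval number `k` of length `2^(-m)`. -/
noncomputable def limMass (x : DyadicSum 1 ∞) (m : ℕ) (k : ℤ) : ℝ := ultraLim (x.mass m k)

theorem tendsto_mass (x : DyadicSum 1 ∞) (m : ℕ) (k : ℤ) :
    Tendsto (x.mass m k) (hyperfilter ℕ : Filter ℕ) (𝓝 (x.limMass m k)) :=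
  tendsto_ultraLim (x.abs_mass_le_norm m k)

/-- Additivity holds from `n = m + 1` on, and a nonprincipal ultrafilter ignores the earlier blocks.
-/
theorem limMass_eq_add (x : DyadicSum 1 ∞) (m : ℕ) (k : ℤ) :
    x.limMass m k = x.limMass (m + 1) (2 * k) + x.limMass (m + 1) (2 * k + 1) := by
  refine ultraLim_eq_of_tendsto (((x.tendsto_mass _ _).add (x.tendsto_mass _ _)).congr' ?_)
  filter_upwards [eventually_hyperfilter_ge (m + 1)] with n hn
  exact (x.mass_eq_add hn k).symm

theorem sum_abs_limMass_le (x : DyadicSum 1 ∞) (m : ℕ) :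
    ∑ k : Fin (2 ^ m), |x.limMass m (k : ℕ)| ≤ ‖x‖ :=
  le_of_tendsto (tendsto_finsetSum _ fun k _ => (x.tendsto_mass m (k : ℕ)).abs)
    (Eventually.of_forall fun n => x.sum_abs_mass_le_norm m n)

theorem limMass_add (x y : DyadicSum 1 ∞) (m : ℕ) (k : ℤ) :
    (x + y).limMass m k = x.limMass m k + y.limMass m k :=
  ultraLim_eq_of_tendsto (((x.tendsto_mass _ _).add (y.tendsto_mass _ _)).congr fun n =>
    (mass_add x y m k n).symm)

theorem limMass_smul (r : ℝ) (x : DyadicSum 1 ∞) (m : ℕ) (k : ℤ) :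
    (r • x).limMass m k = r * x.limMass m k :=
  ultraLim_eq_of_tendsto (((x.tendsto_mass _ _).const_mul r).congr fun n =>
    (mass_smul r x m k n).symm)

/-- The density of the absolutely continuous part of the limit mass. -/
noncomputable def density (x : DyadicSum 1 ∞) : L1UnitInterval :=
  (exists_tendsto_dyadicDensity x.limMass_eq_add x.sum_abs_limMass_le).choose

theorem tendsto_density (x : DyadicSum 1 ∞) :
    ∀ᵐ t ∂unitVolume, Tendsto (fun n => dyadicDensity x.limMass n t) atTop (𝓝 (x.density t)) :=
  (exists_tendsto_dyadicDensity x.limMass_eq_add x.sum_abs_limMass_le).choose_spec.1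

theorem norm_density_le (x : DyadicSum 1 ∞) : ‖x.density‖ ≤ ‖x‖ :=
  (exists_tendsto_dyadicDensity x.limMass_eq_add x.sum_abs_limMass_le).choose_spec.2

/-- The density of the absolutely continuous part of the limit mass, as a bounded operator. -/
noncomputable def toL1 : DyadicSum 1 ∞ →L[ℝ] L1UnitInterval :=
  LinearMap.mkContinuous
    { toFun := density
      -- Although `density` is obtained by choice, its class is determined by the a.e. limit, so
      -- linearity follows from uniqueness of limits.
      map_add' := fun x y => by
        refine Lp.ext ?_
        filter_upwards [tendsto_density x, tendsto_density y, tendsto_density (x + y),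
          Lp.coeFn_add x.density y.density] with t hx hy hxy hadd
        rw [hadd]
        refine tendsto_nhds_unique hxy ((hx.add hy).congr fun n => ?_)
        simp only [dyadicDensity, limMass_add, mul_add]
      map_smul' := fun r x => by
        refine Lp.ext ?_
        filter_upwards [tendsto_density x, tendsto_density (r • x),
          Lp.coeFn_smul r x.density] with t hx hrx hsmul
        rw [RingHom.id_apply, hsmul]
        refine tendsto_nhds_unique hrx ((hx.const_mul r).congr fun n => ?_)
        simp only [dyadicDensity, limMass_smul, mul_left_comm] }
    1 fun x => by rw [one_mul]; exact norm_density_le x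

end DyadicSum

/-! ### The embedding of `L_1[0,1]` and its left inverse -/

theorem L1UnitInterval.sum_abs_setIntegral_le (f : L1UnitInterval) (n : ℕ) :
    ∑ i : Fin (2 ^ n), |∫ t in dyadicInterval n (i : ℕ), f t ∂unitVolume| ≤ ‖f‖ := by
  have hf := L1.integrable_coeFn f
  rw [L1.norm_eq_integral_norm, integral_eq_sum_dyadicInterval hf.norm n]
  exact Finset.sum_le_sum fun i _ => abs_integral_le_integral_abs

/-- The dyadic blocks `(∫ f over the dyadic intervals of length 2^(-n))_n` of an integrable
function. -/
noncomputable def L1UnitInterval.toBlocks (f : L1UnitInterval) (n : ℕ) : FinEll 1 (2 ^ n) :=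
  WithLp.toLp 1 fun i => ∫ t in dyadicInterval n (i : ℕ), f t ∂unitVolume

theorem L1UnitInterval.norm_toBlocks_le (f : L1UnitInterval) (n : ℕ) : ‖f.toBlocks n‖ ≤ ‖f‖ := by
  rw [PiLp.norm_eq_of_L1]
  exact f.sum_abs_setIntegral_le n

/-- The embedding of `L_1[0,1]` by the integrals over the dyadic intervals. -/
noncomputable def L1UnitInterval.toDyadicSum : L1UnitInterval →L[ℝ] DyadicSum 1 ∞ :=
  LinearMap.mkContinuous
    { toFun := fun f => ⟨f.toBlocks,
        memℓp_infty_iff.2 ⟨‖f‖, by rintro _ ⟨n, rfl⟩; exact f.norm_toBlocks_le n⟩⟩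
      map_add' := fun f g => by
        refine Subtype.ext (funext fun n => ?_)
        ext i
        refine (integral_congr_ae (ae_restrict_of_ae (Lp.coeFn_add f g))).trans ?_
        exact integral_add (L1.integrable_coeFn f).integrableOn (L1.integrable_coeFn g).integrableOn
      map_smul' := fun r f => by
        refine Subtype.ext (funext fun n => ?_)
        ext i
        refine (integral_congr_ae (ae_restrict_of_ae (Lp.coeFn_smul r f))).trans ?_
        exact integral_const_mul r _ }
    1 fun f => by
      rw [one_mul]
      exact lp.norm_le_of_forall_le (norm_nonneg f) f.norm_toBlocks_le

/-- For `n ≥ m` the level-`n` integrals inside a level-`m` interval add up to its integral, so the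
masses are eventually constant. -/
theorem L1UnitInterval.limMass_toDyadicSum (f : L1UnitInterval) (m : ℕ) (k : ℤ) :
    f.toDyadicSum.limMass m k = ∫ t in dyadicInterval m k, f t ∂unitVolume := by
  refine ultraLim_eq_of_tendsto (tendsto_const_nhds.congr' ?_)
  filter_upwards [eventually_hyperfilter_ge m] with n hn
  obtain ⟨d, rfl⟩ := Nat.exists_eq_add_of_le hn
  have h : dyadicInterval m k = dyadicIndex (m + d) ⁻¹' {j | j / 2 ^ d = k} := by
    ext t
    simp only [dyadicInterval, Set.mem_preimage, Set.mem_singleton_iff, Set.mem_ofPred_eq,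
      dyadicIndex_add_div]
  rw [h, setIntegral_preimage_dyadicIndex (L1.integrable_coeFn f), DyadicSum.mass]
  refine Finset.sum_congr rfl fun i _ => ?_
  simp only [Nat.add_sub_cancel_left, Set.mem_ofPred_eq]
  congr

/-- The densities of the limit mass of `f` are exactly its dyadic means. -/
theorem L1UnitInterval.toL1_toDyadicSum (f : L1UnitInterval) :
    DyadicSum.toL1 f.toDyadicSum = f := by
  refine Lp.ext ?_
  filter_upwards [f.toDyadicSum.tendsto_density, tendsto_dyadicMean (L1.integrable_coeFn f)]
    with t h1 h2
  refine tendsto_nhds_unique h1 (h2.congr fun n => ?_)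
  rw [dyadicMean, dyadicDensity, L1UnitInterval.limMass_toDyadicSum]

/-- A bounded operator with a bounded left inverse is an isomorphism onto its range. -/
def ContinuousLinearMap.equivRangeOfLeftInverse {E F : Type*} [NormedAddCommGroup E]
    [NormedSpace ℝ E] [NormedAddCommGroup F] [NormedSpace ℝ F] (J : E →L[ℝ] F) (P : F →L[ℝ] E)
    (h : Function.LeftInverse P J) : J.range ≃L[ℝ] E :=
  ContinuousLinearEquiv.equivOfInverse (P.comp J.range.subtypeL) J.rangeRestrict
    (by rintro ⟨_, x, rfl⟩; exact Subtype.ext (congrArg J (h x))) h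

theorem corollary3p4 :
    Nonempty (TandoriL1 ≃L[ℝ] DyadicSum ∞ 1) ∧
    Nonempty (CesInfty ≃L[ℝ] DyadicSum 1 ∞) ∧
    ∃ E : Submodule ℝ CesInfty,
      E.ClosedComplemented ∧ Nonempty (E ≃L[ℝ] L1UnitInterval) := by
  refine ⟨⟨TandoriL1.equivDyadicSum⟩, ⟨CesInfty.equivDyadicSum⟩, ?_⟩
  set e := CesInfty.equivDyadicSum
  let J : L1UnitInterval →L[ℝ] CesInfty :=
    (e.symm : DyadicSum 1 ∞ →L[ℝ] CesInfty).comp L1UnitInterval.toDyadicSum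
  let P : CesInfty →L[ℝ] L1UnitInterval :=
    DyadicSum.toL1.comp (e : CesInfty →L[ℝ] DyadicSum 1 ∞)
  have h : Function.LeftInverse P J := fun f => by
    refine Eq.trans ?_ f.toL1_toDyadicSum
    exact congrArg DyadicSum.toL1 (e.apply_symm_apply _)
  exact ⟨J.range, J.closedComplemented_range_of_leftInverse P h,
    ⟨J.equivRangeOfLeftInverse P h⟩⟩
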